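/- Let $I$ be a finite set of agents and $\Theta$ a compact Hausdorff space. For a compact Hausdorff space $X$, let $\Delta(X)$ be the space of regular Borel probability measures on $X$ with the topology of weak convergence (if $X$ is metrizable these are all the Borel probability measures), which is again compact Hausdorff. Let $T^*_i$ denote the universal type space of agent $i$, i.e. the inverse limit of the spaces of coherent finite-order belief hierarchies of agent $i$ on $\Theta$, and let $\beta^*_i : T^*_i\to\Delta(\Theta\times\prod_{j\ne i}T^*_j)$ be the map sending a type to the unique measure whose marginals are the beliefs in its hierarchy. A *state space* is a nonempty compact set $\Omega=\Theta\times\prod_{j\in I}T_j$ with $T_j\subseteq T^*_j$. An *agent-$i$-dependent type structure* $\mathfrak T^i(T_i)$ consists of nonempty compact sets $\mathsf T^i_j\subseteq T^*_j$ $(j\in I)$ with $T_i\subseteq\mathsf T^i_i$, and continuous maps $\beta^i_j:\mathsf T^i_j\to\Delta(\Theta\times\prod_{k\ne j}\mathsf T^i_k)$ that are the restrictions of $\beta^*_j$. Its state space is $\Omega^i:=\Theta\times\prod_{j\in I}\mathsf T^i_j$, and an *event* is a closed product subset of $\Omega^i$. For an event $E$ in $\Omega^i$ let $E_{-j}$ be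 its projection to $\Theta\times\prod_{k\ne j}\mathsf T^i_k$, and put $$\mathrm B(E):=\{(\theta,t)\in\Omega^i:\ \beta^i_j(t_j)(E_{-j})=1\ \text{for all } j\in I\},$$ $$\mathrm{CB}^0(E):=E,\qquad \mathrm{CB}^m(E):=E\cap\bigcap_{k=0}^{m-1}\mathrm B(\mathrm{CB}^k(E))\quad(m\ge1).$$ Agent $i$'s real $m$-order correct-belief event and real common-correct-belief event are $$\mathbf{CB}^m_i(E):=\bigl(\mathrm{proj}_{\mathsf T^i_i}\mathrm{CB}^m(E)\bigr)\cap T_i,\qquad \mathbf{CB}^\infty_i(E):=\bigcap_{\ell\ge0}\mathbf{CB}^\ell_i(E).$$ For a profile $(\mathfrak T^j(T_j))_{j\in I}$ of agent-dependent type structures and a profile $E^\bullet=(E^j)_{j\in I}$ of events, $E^j\subseteq\Omega^j$, let $\mathbf{CB}^m(E^\bullet):=\prod_{j\in I}\mathbf{CB}^m_j(E^j)$ and $\mathbf{CB}^\infty(E^\bullet):=\prod_{j\in I}\mathbf{CB}^\infty_j(E^j)$. **Proposition (Measurability).** Let $\Omega$ be a state space. For every agent $i$, every agent-$i$-dependent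 type structure $\mathfrak T^i(T_i)$, every event $E^i\subseteq\Omega^i$ and every $m\ge0$, the sets $\mathbf{CB}^m_i(E^i)$ and $\mathbf{CB}^\infty_i(E^i)$ are closed in $T^*_i$, hence Borel measurable. For every profile of agent-dependent type structures, every profile $E^\bullet$ of events and every $m\ge0$, the sets $\mathbf{CB}^m(E^\bullet)$ and $\mathbf{CB}^\infty(E^\bullet)$ are closed in $\prod_{j\in I}T^*_j$, hence measurable, both for the Borel $\sigma$-algebra of the product and for the product of the Borel $\sigma$-algebras. -/

import Mathlib

open MeasureTheory Set Filter Topology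

universe u v

set_option linter.style.haveILetI false
set_option linter.unusedSectionVars false

/-- `Delta X`: the regular (Radon) Borel probability measures on `X`. -/
structure Delta (X : Type u) [TopologicalSpace X] : Type u where
  toMeasure : @Measure X (borel X)
  isProb : @IsProbabilityMeasure X (borel X) toMeasure
  isRegular : @Measure.Regular X (borel X) _ toMeasure

namespace Delta

/-- The underlying element of Mathlib's space of Borel probability measures. -/
def toProb {X : Type u} [TopologicalSpace X] (μ : Delta X) :
    @ProbabilityMeasure X (borel X) :=
  ⟨μ.toMeasure, μ.isProb⟩

/-- The topology of weak convergence. -/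
noncomputable instance instTopology (X : Type u) [TopologicalSpace X] : TopologicalSpace (Delta X) :=
  letI : MeasurableSpace X := borel X
  haveI : BorelSpace X := ⟨rfl⟩
  TopologicalSpace.induced toProb inferInstance

theorem toMeasure_injective {X : Type u} [TopologicalSpace X] :
    Function.Injective (toMeasure : Delta X → @Measure X (borel X)) := by
  rintro ⟨μ, _, _⟩ ⟨ν, _, _⟩ h
  cases h
  rfl

/-- The integral of a continuous function. -/
noncomputable def integral {X : Type u} [TopologicalSpace X] (μ : Delta X) (f : C(X, ℝ)) : ℝ :=
  letI : MeasurableSpace X := borel X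
  ∫ x, f x ∂μ.toMeasure

section Compact

variable {X : Type u} [TopologicalSpace X] {Y : Type v} [TopologicalSpace Y]

variable [CompactSpace X] [T2Space X]

theorem ext_integral {μ ν : Delta X} (h : ∀ f : C(X, ℝ), μ.integral f = ν.integral f) :
    μ = ν := by
  letI : MeasurableSpace X := borel X
  haveI : BorelSpace X := ⟨rfl⟩
  haveI := μ.isProb
  haveI := ν.isProb
  haveI := μ.isRegular
  haveI := ν.isRegular
  refine toMeasure_injective ?_
  exact Measure.ext_of_integral_eq_on_compactlySupported (μ := μ.toMeasure) (ν := ν.toMeasure)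
    fun f => h f.toContinuousMap

theorem exists_integral_eq {m : MeasurableSpace X} (hm : m = borel X)
    (μ : Measure X) [IsProbabilityMeasure μ] :
    ∃ ν : Delta X, ∀ f : C(X, ℝ), ν.integral f = ∫ x, f x ∂μ := by
  subst hm
  letI : MeasurableSpace X := borel X
  haveI : BorelSpace X := ⟨rfl⟩
  obtain ⟨ν, hreg, hfin, hν⟩ := Measure.exists_regular_eq_of_compactSpace μ
  have h1 : IsProbabilityMeasure ν := by
    have := hν 1
    simp only [BoundedContinuousFunction.coe_one, Pi.one_apply, integral_const, smul_eq_mul,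
      mul_one, probReal_univ] at this
    refine ⟨?_⟩
    rw [measureReal_def] at this
    rw [← ENNReal.ofReal_toReal (measure_ne_top ν univ), ← this, ENNReal.ofReal_one]
  refine ⟨⟨ν, h1, hreg⟩, fun f => ?_⟩
  exact (hν (BoundedContinuousFunction.mkOfCompact f)).symm

theorem continuous_integral (f : C(X, ℝ)) : Continuous fun μ : Delta X => μ.integral f := by
  letI : MeasurableSpace X := borel X
  haveI : BorelSpace X := ⟨rfl⟩
  exact (ProbabilityMeasure.continuous_integral_boundedContinuousFunction
    (BoundedContinuousFunction.mkOfCompact f)).comp (continuous_induced_dom (f := toProb))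

theorem continuous_of_integral {F : Y → Delta X}
    (h : ∀ f : C(X, ℝ), Continuous fun y => (F y).integral f) : Continuous F := by
  letI : MeasurableSpace X := borel X
  haveI : BorelSpace X := ⟨rfl⟩
  refine continuous_induced_rng.2 ?_
  rw [ProbabilityMeasure.continuous_iff_forall_continuousMap_continuous_integral]
  exact h

instance instT2 : T2Space (Delta X) := by
  refine ⟨fun μ ν hne => ?_⟩
  have : ∃ f : C(X, ℝ), μ.integral f ≠ ν.integral f := by
    by_contra! h
    exact hne (ext_integral h)
  obtain ⟨f, hf⟩ := this
  exact separated_by_continuous (continuous_integral f) hf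

instance instCompact : CompactSpace (Delta X) := by
  letI : MeasurableSpace X := borel X
  haveI : BorelSpace X := ⟨rfl⟩
  choose R hR using fun μ : ProbabilityMeasure X => exists_integral_eq rfl (μ : Measure X)
  have hc : Continuous R := continuous_of_integral fun f => by
    simp only [hR]
    exact ProbabilityMeasure.continuous_integral_boundedContinuousFunction
      (BoundedContinuousFunction.mkOfCompact f)
  have hs : Function.Surjective R := fun μ => ⟨μ.toProb, ext_integral fun f => hR _ f⟩
  exact ⟨by rw [← hs.range_eq]; exact isCompact_range hc⟩

end Compact

section Map

variable {X : Type u} [TopologicalSpace X] [T2Space X]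
  {Y : Type v} [TopologicalSpace Y] [T2Space Y]

/-- The image measure under a continuous map. -/
noncomputable def map (g : C(X, Y)) (μ : Delta X) : Delta Y :=
  letI : MeasurableSpace X := borel X
  haveI : BorelSpace X := ⟨rfl⟩
  letI : MeasurableSpace Y := borel Y
  haveI : BorelSpace Y := ⟨rfl⟩
  haveI := μ.isProb
  haveI := μ.isRegular
  ⟨μ.toMeasure.map g, Measure.isProbabilityMeasure_map g.continuous.aemeasurable, by
    haveI : μ.toMeasure.InnerRegular := inferInstance
    haveI : (μ.toMeasure.map g).InnerRegular :=
      Measure.InnerRegular.map_of_continuous g.continuous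
    exact (inferInstance : (μ.toMeasure.map g).Regular)⟩

theorem integral_map (g : C(X, Y)) (μ : Delta X) (f : C(Y, ℝ)) :
    (map g μ).integral f = μ.integral (f.comp g) := by
  letI : MeasurableSpace X := borel X
  haveI : BorelSpace X := ⟨rfl⟩
  letI : MeasurableSpace Y := borel Y
  haveI : BorelSpace Y := ⟨rfl⟩
  exact MeasureTheory.integral_map g.continuous.aemeasurable
    f.continuous.aestronglyMeasurable

theorem continuous_map [CompactSpace X] [CompactSpace Y] (g : C(X, Y)) : Continuous (map g : Delta X → Delta Y) :=
  continuous_of_integral fun f => by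
    simp only [integral_map]
    exact continuous_integral _

end Map

section Limit

theorem compl_null {X : Type u} [TopologicalSpace X] [CompactSpace X] [T2Space X]
    (μ : Delta X) {F : Set X} (hF : IsClosed F)
    (h : ∀ f : C(X, ℝ), (∀ x ∈ F, f x = 0) → μ.integral f = 0) : μ.toMeasure Fᶜ = 0 := by
  letI : MeasurableSpace X := borel X
  haveI : BorelSpace X := ⟨rfl⟩
  haveI := μ.isProb
  haveI := μ.isRegular
  rw [hF.isOpen_compl.measure_eq_iSup_isCompact]
  simp only [ENNReal.iSup_eq_zero]
  intro K hKF hK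
  obtain ⟨f, hf1, hf0, -, hf⟩ := exists_continuous_one_zero_of_isCompact hK hF
    (disjoint_left.2 fun x hx hx' => hKF hx hx')
  have h0 : ∫ x, f x ∂μ.toMeasure = 0 := h f fun x hx => hf0 hx
  have hint : Integrable (fun x => f x) μ.toMeasure :=
    (BoundedContinuousFunction.mkOfCompact f).integrable _
  rw [integral_eq_zero_iff_of_nonneg (fun x => (hf x).1) hint] at h0
  refine measure_mono_null (fun x hx => ?_) (ae_iff.1 h0)
  simp [hf1 hx]

theorem exists_restrict {X : Type u} [TopologicalSpace X] [CompactSpace X] [T2Space X]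
    (μ : Delta X) {F : Set X} (hF : IsClosed F) [CompactSpace F] (h : μ.toMeasure Fᶜ = 0) :
    ∃ ν : Delta F, map ⟨Subtype.val, continuous_subtype_val⟩ ν = μ := by
  letI : MeasurableSpace X := borel X
  haveI : BorelSpace X := ⟨rfl⟩
  haveI := μ.isProb
  haveI := μ.isRegular
  have hr : μ.toMeasure.restrict F = μ.toMeasure := Measure.restrict_eq_self_of_ae_mem h
  have hm : (μ.toMeasure.comap ((↑) : F → X)).map (↑) = μ.toMeasure := by
    rw [map_comap_subtype_coe hF.measurableSet, hr]
  haveI : IsProbabilityMeasure (μ.toMeasure.comap ((↑) : F → X)) := by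
    refine ⟨?_⟩
    rw [← preimage_univ (f := ((↑) : F → X)),
      ← Measure.map_apply measurable_subtype_coe MeasurableSet.univ, hm]
    exact measure_univ
  obtain ⟨ν, hν⟩ := exists_integral_eq (BorelSpace.measurable_eq (α := F))
    (μ.toMeasure.comap ((↑) : F → X))
  refine ⟨ν, ext_integral fun f => ?_⟩
  rw [integral_map, hν]
  change _ = ∫ x, f x ∂μ.toMeasure
  conv_rhs => rw [← hm]
  rw [MeasureTheory.integral_map measurable_subtype_coe.aemeasurable
    f.continuous.aestronglyMeasurable]
  rfl

variable {X : ℕ → Type u} [∀ n, TopologicalSpace (X n)] [∀ n, CompactSpace (X n)]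
  [∀ n, T2Space (X n)]

/-- Continuous maps sending a point of the `n`-th space to the sequence of its images in the lower
spaces, completed arbitrarily. -/
noncomputable def seqOf (p : ∀ n, C(X (n + 1), X n)) (d : ∀ n, X n) : ∀ n, X n → ∀ k, X k
  | 0, x => Function.update d 0 x
  | n + 1, x => Function.update (seqOf p d n (p n x)) (n + 1) x

theorem continuous_seqOf (p : ∀ n, C(X (n + 1), X n)) (d : ∀ n, X n) :
    ∀ n, Continuous (seqOf p d n)
  | 0 => continuous_const.update 0 continuous_id
  | n + 1 => ((continuous_seqOf p d n).comp (p n).continuous).update (n + 1) continuous_id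

theorem seqOf_self (p : ∀ n, C(X (n + 1), X n)) (d : ∀ n, X n) (n : ℕ) (x : X n) :
    seqOf p d n x n = x := by
  cases n <;> simp [seqOf]

theorem seqOf_succ (p : ∀ n, C(X (n + 1), X n)) (d : ∀ n, X n) {n k : ℕ} (hk : k ≤ n)
    (x : X (n + 1)) : seqOf p d (n + 1) x k = seqOf p d n (p n x) k := by
  simp only [seqOf]
  rw [Function.update_of_ne (by omega)]

theorem seqOf_coherent (p : ∀ n, C(X (n + 1), X n)) (d : ∀ n, X n) {n k : ℕ} (hk : k < n)
    (x : X n) : p k (seqOf p d n x (k + 1)) = seqOf p d n x k := by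
  induction n with
  | zero => omega
  | succ n ih =>
    rw [seqOf_succ p d (by omega : k ≤ n)]
    rcases Nat.lt_succ_iff_lt_or_eq.1 hk with h | rfl
    · rw [seqOf_succ p d (by omega : k + 1 ≤ n), ih h]
    · rw [seqOf_self, seqOf_self]

theorem map_seqOf (p : ∀ n, C(X (n + 1), X n)) (d : ∀ n, X n) (μ : ∀ n, Delta (X n))
    (hμ : ∀ n, map (p n) (μ (n + 1)) = μ n) {n k : ℕ} (hk : k ≤ n) (f : C(X k, ℝ)) :
    (map ⟨seqOf p d n, continuous_seqOf p d n⟩ (μ n)).integral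
      (f.comp ⟨fun x => x k, continuous_apply k⟩) = (μ k).integral f := by
  induction n with
  | zero =>
    obtain rfl : k = 0 := by omega
    rw [integral_map]
    congr 1
  | succ n ih =>
    rcases Nat.le_succ_iff.1 hk with h | rfl
    · rw [← ih h, integral_map, integral_map, ← hμ n, integral_map]
      congr 1
      ext x
      simp [seqOf_succ p d h]
    · rw [integral_map]
      congr 1
      ext x
      simp [seqOf_self]

theorem nonempty_of (Y : Type u) [TopologicalSpace Y] (μ : Delta Y) : Nonempty Y := by
  letI : MeasurableSpace Y := borel Y
  haveI := μ.isProb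
  exact nonempty_of_isProbabilityMeasure μ.toMeasure

/-- A compatible sequence of measures on an inverse sequence of compact Hausdorff spaces extends
to the inverse limit. -/
theorem exists_limit_seq (p : ∀ n, C(X (n + 1), X n)) (μ : ∀ n, Delta (X n))
    (hμ : ∀ n, map (p n) (μ (n + 1)) = μ n)
    [CompactSpace {x : ∀ n, X n // ∀ n, p n (x (n + 1)) = x n}] :
    ∃ ν : Delta {x : ∀ n, X n // ∀ n, p n (x (n + 1)) = x n},
      ∀ n, map ⟨fun x => x.1 n, (continuous_apply n).comp continuous_subtype_val⟩ ν = μ n := by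
  have hd : ∀ n, Nonempty (X n) := fun n => nonempty_of _ (μ n)
  let d : ∀ n, X n := fun n => (hd n).some
  let N : ℕ → Delta (∀ n, X n) := fun n => map ⟨seqOf p d n, continuous_seqOf p d n⟩ (μ n)
  obtain ⟨ν, hν⟩ : ∃ ν, ((hyperfilter ℕ).map N : Filter (Delta (∀ n, X n))) ≤ 𝓝 ν :=
    ⟨_, ((hyperfilter ℕ).map N).le_nhds_lim⟩
  have hlim : ∀ f : C(∀ n, X n, ℝ),
      Tendsto (fun n => (N n).integral f) (hyperfilter ℕ) (𝓝 (ν.integral f)) := fun f =>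
    ((continuous_integral f).tendsto ν).comp hν
  have hev : ∀ (f : C(∀ n, X n, ℝ)) (c : ℝ) (k : ℕ), (∀ n, k ≤ n → (N n).integral f = c) →
      ν.integral f = c := fun f c k h =>
    tendsto_nhds_unique (hlim f) (tendsto_const_nhds.congr' (by
      have : ∀ᶠ n in (hyperfilter ℕ : Filter ℕ), k ≤ n :=
        Nat.hyperfilter_le_atTop (eventually_ge_atTop k)
      filter_upwards [this] with n hn using (h n hn).symm))
  have hcl : ∀ k, IsClosed {x : ∀ n, X n | p k (x (k + 1)) = x k} := fun k =>
    isClosed_eq ((p k).continuous.comp (continuous_apply _)) (continuous_apply _)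
  have hLc : IsClosed {x : ∀ n, X n | ∀ n, p n (x (n + 1)) = x n} := by
    rw [ofPred_forall]
    exact isClosed_iInter hcl
  have h0 : ν.toMeasure {x : ∀ n, X n | ∀ n, p n (x (n + 1)) = x n}ᶜ = 0 := by
    letI : MeasurableSpace (∀ n, X n) := borel _
    rw [ofPred_forall, compl_iInter, measure_iUnion_null_iff]
    intro k
    refine compl_null ν (hcl k) fun f hf => hev f 0 (k + 1) fun n hn => ?_
    rw [integral_map]
    have : f.comp ⟨seqOf p d n, continuous_seqOf p d n⟩ = 0 := by
      ext x
      exact hf _ (seqOf_coherent p d (by omega) x)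
    rw [this]
    simp [integral]
  haveI : CompactSpace {x : ∀ n, X n | ∀ n, p n (x (n + 1)) = x n} :=
    isCompact_iff_compactSpace.1 hLc.isCompact
  obtain ⟨ρ, hρ⟩ := exists_restrict ν hLc h0
  refine ⟨ρ, fun n => ext_integral fun f => ?_⟩
  rw [integral_map]
  have := hev (f.comp ⟨fun x => x n, continuous_apply n⟩) _ n
    fun m hm => map_seqOf p d μ hμ hm f
  rw [← this, ← hρ, integral_map]
  rfl

theorem exists_unique_limit (p : ∀ n, C(X (n + 1), X n)) (μ : ∀ n, Delta (X n))
    (hμ : ∀ n, map (p n) (μ (n + 1)) = μ n) {Z : Type v} [TopologicalSpace Z] [CompactSpace Z]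
    [T2Space Z] (q : ∀ n, C(Z, X n)) (hq : ∀ n z, p n (q (n + 1) z) = q n z)
    (hex : ∀ x : ∀ n, X n, (∀ n, p n (x (n + 1)) = x n) → ∃ z, ∀ n, q n z = x n)
    (hinj : ∀ z z', (∀ n, q n z = q n z') → z = z') :
    ∃! ν : Delta Z, ∀ n, map (q n) ν = μ n := by
  let L := {x : ∀ n, X n // ∀ n, p n (x (n + 1)) = x n}
  let e : Z → L := fun z => ⟨fun n => q n z, fun n => hq n z⟩
  have hec : Continuous e :=
    Continuous.subtype_mk (continuous_pi fun n => (q n).continuous) _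
  have hinj' : Function.Injective e := fun z z' h => hinj z z' fun n =>
    congrFun (congrArg Subtype.val h) n
  have hsurj : Function.Surjective e := fun x => by
    obtain ⟨z, hz⟩ := hex x.1 x.2
    exact ⟨z, Subtype.ext (funext hz)⟩
  let E : Z ≃ₜ L := Continuous.homeoOfEquivCompactToT2 (f := Equiv.ofBijective e ⟨hinj', hsurj⟩) hec
  haveI : CompactSpace L := E.compactSpace
  obtain ⟨ρ, hρ⟩ := exists_limit_seq p μ hμ
  have hE : ∀ x : L, e (E.symm x) = x := fun x => E.apply_symm_apply x
  refine ⟨map ⟨E.symm, E.symm.continuous⟩ ρ, fun n => ext_integral fun f => ?_, ?_⟩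
  · rw [integral_map, integral_map, ← hρ n, integral_map]
    congr 1
    ext x
    exact congrArg f (congrFun (congrArg Subtype.val (hE x)) n)
  · have key : ∀ ν ν' : Delta Z, (∀ n, map (q n) ν = μ n) → (∀ n, map (q n) ν' = μ n) →
        ν = ν' := by
      intro ν ν' h h'
      letI : MeasurableSpace Z := borel Z
      haveI : BorelSpace Z := ⟨rfl⟩
      letI : ∀ n, MeasurableSpace (X n) := fun n => borel (X n)
      haveI : ∀ n, BorelSpace (X n) := fun n => ⟨rfl⟩
      haveI := ν.isProb
      haveI := ν.isRegular
      haveI := ν'.isProb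
      haveI := ν'.isRegular
      refine toMeasure_injective (Measure.OuterRegular.ext_isOpen fun U hU =>
        Measure.InnerRegularWRT.eq_of_innerRegularWRT_of_forall_eq (p := IsCompact) (q := IsOpen)
          Measure.Regular.innerRegular Measure.Regular.innerRegular (fun K hK => ?_) hU)
      let S : ℕ → Set Z := fun n => q n ⁻¹' (q n '' K)
      have hSanti : Antitone S := antitone_nat_of_succ_le fun n z hz => by
        obtain ⟨k, hk, hkz⟩ := hz
        exact ⟨k, hk, by rw [← hq, hkz, hq]⟩
      have hKS : K = ⋂ n, S n := by
        refine Subset.antisymm (subset_iInter fun n => subset_preimage_image _ _) fun z hz => ?_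
        have hcl : ∀ n, IsClosed {k : Z | q n k = q n z} := fun n =>
          isClosed_eq (q n).continuous continuous_const
        obtain ⟨k, hk⟩ := IsCompact.nonempty_iInter_of_sequence_nonempty_isCompact_isClosed
          (fun n => K ∩ {k : Z | q n k = q n z})
          (fun n k hk => ⟨hk.1, by
            have h2 : q (n + 1) k = q (n + 1) z := hk.2
            change q n k = q n z
            rw [← hq, h2, hq]⟩)
          (fun n => mem_iInter.1 hz n) (hK.inter_right (hcl 0))
          (fun n => hK.isClosed.inter (hcl n))
        rw [mem_iInter] at hk
        rw [← hinj k z fun n => (hk n).2]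
        exact (hk 0).1
      have hSm : ∀ n, MeasurableSet (q n '' K) := fun n =>
        (hK.image (q n).continuous).isClosed.measurableSet
      have hSeq : ∀ n, ν.toMeasure (S n) = ν'.toMeasure (S n) := fun n => by
        have h1 := congrArg toMeasure ((h n).trans (h' n).symm)
        change ν.toMeasure.map (q n) = ν'.toMeasure.map (q n) at h1
        rw [← Measure.map_apply (q n).continuous.measurable (hSm n), h1,
          Measure.map_apply (q n).continuous.measurable (hSm n)]
      have hSn : ∀ n, MeasurableSet (S n) := fun n => (q n).continuous.measurable (hSm n)
      rw [hKS]
      refine tendsto_nhds_unique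
        (tendsto_measure_iInter_atTop (μ := ν.toMeasure)
          (fun n => (hSn n).nullMeasurableSet) hSanti ⟨0, measure_ne_top _ _⟩) ?_
      have := tendsto_measure_iInter_atTop (μ := ν'.toMeasure)
          (fun n => (hSn n).nullMeasurableSet) hSanti ⟨0, measure_ne_top _ _⟩
      refine this.congr fun n => (hSeq n).symm
    intro ν hν
    refine key _ _ hν fun n => ext_integral fun f => ?_
    rw [integral_map, integral_map, ← hρ n, integral_map]
    congr 1
    ext x
    exact congrArg f (congrFun (congrArg Subtype.val (hE x)) n)

end Limit
end Delta

/-- `Others Y i` is the product of the spaces `Y j` over all `j ≠ i`. -/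
abbrev Others {I : Type} (Y : I → Type u) (i : I) : Type u := ∀ j : {j : I // j ≠ i}, Y j

/-- One step of the construction of belief hierarchies: for each agent `i`, the domain `Dom i` of
the beliefs of the current order, the space `Ty i` of coherent hierarchies up to the current order,
the projection `restrict i` from the next domain to the current one, and the belief `last i` of the
current order. All spaces are compact Hausdorff. -/
structure Stage (I : Type) (Θ : Type u) [TopologicalSpace Θ] where
  Dom : I → Type u
  Ty : I → Type u
  [topDom : ∀ i, TopologicalSpace (Dom i)]
  [compactDom : ∀ i, CompactSpace (Dom i)]
  [t2Dom : ∀ i, T2Space (Dom i)]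
  [topTy : ∀ i, TopologicalSpace (Ty i)]
  [compactTy : ∀ i, CompactSpace (Ty i)]
  [t2Ty : ∀ i, T2Space (Ty i)]
  restrict : ∀ i, C(Θ × Others Ty i, Dom i)
  last : ∀ i, C(Ty i, Delta (Dom i))

attribute [instance] Stage.topDom Stage.compactDom Stage.t2Dom Stage.topTy Stage.compactTy
  Stage.t2Ty

section Hierarchies

variable (I : Type) (Θ : Type u) [TopologicalSpace Θ] [CompactSpace Θ] [T2Space Θ]

/-- First order: beliefs about `Θ`. -/
noncomputable def Stage.first : Stage I Θ where
  Dom _ := Θ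
  Ty _ := Delta Θ
  restrict _ := ⟨Prod.fst, continuous_fst⟩
  last _ := ContinuousMap.id _

variable {I Θ}

/-- Hierarchies of the next order: pairs of a hierarchy of the current order and a belief about
`Θ` and the current hierarchies of the other agents, whose marginal is the current belief. -/
def Stage.NextTy (S : Stage I Θ) (i : I) : Type u :=
  {x : S.Ty i × Delta (Θ × Others S.Ty i) // Delta.map (S.restrict i) x.2 = S.last i x.1}

instance (S : Stage I Θ) (i : I) : TopologicalSpace (S.NextTy i) :=
  inferInstanceAs (TopologicalSpace {x : S.Ty i × Delta (Θ × Others S.Ty i) //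
    Delta.map (S.restrict i) x.2 = S.last i x.1})

instance (S : Stage I Θ) (i : I) : T2Space (S.NextTy i) :=
  inferInstanceAs (T2Space {x : S.Ty i × Delta (Θ × Others S.Ty i) //
    Delta.map (S.restrict i) x.2 = S.last i x.1})

instance (S : Stage I Θ) (i : I) : CompactSpace (S.NextTy i) :=
  isCompact_iff_compactSpace.1 (IsClosed.isCompact (isClosed_eq
    ((Delta.continuous_map (S.restrict i)).comp continuous_snd)
    ((S.last i).continuous.comp continuous_fst)))

/-- Forget the belief of the highest order. -/
def Stage.forget (S : Stage I Θ) (i : I) : C(S.NextTy i, S.Ty i) :=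
  ⟨fun x => x.1.1, continuous_fst.comp continuous_subtype_val⟩

def Stage.next (S : Stage I Θ) : Stage I Θ where
  Dom i := Θ × Others S.Ty i
  Ty i := S.NextTy i
  restrict i := ⟨fun x => (x.1, fun j => S.forget j (x.2 j)), by fun_prop⟩
  last i := ⟨fun x => x.1.2, continuous_snd.comp continuous_subtype_val⟩

variable (I Θ)

/-- `stage I Θ n` describes the beliefs of order `n + 1`. -/
noncomputable def stage : ℕ → Stage I Θ
  | 0 => Stage.first I Θ
  | n + 1 => (stage n).next

/-- The universal type space of agent `i`: the inverse limit of the spaces of coherent hierarchies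
of finite order. -/
def UType (i : I) : Type u :=
  {t : ∀ n, (stage I Θ n).Ty i // ∀ n, (stage I Θ n).forget i (t (n + 1)) = t n}

instance (i : I) : TopologicalSpace (UType I Θ i) :=
  inferInstanceAs (TopologicalSpace
    {t : ∀ n, (stage I Θ n).Ty i // ∀ n, (stage I Θ n).forget i (t (n + 1)) = t n})

instance (i : I) : T2Space (UType I Θ i) :=
  inferInstanceAs (T2Space
    {t : ∀ n, (stage I Θ n).Ty i // ∀ n, (stage I Θ n).forget i (t (n + 1)) = t n})

instance (i : I) : CompactSpace (UType I Θ i) := by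
  have h : IsClosed {t : ∀ n, (stage I Θ n).Ty i |
      ∀ n, (stage I Θ n).forget i (t (n + 1)) = t n} := by
    rw [ofPred_forall]
    exact isClosed_iInter fun n => isClosed_eq
      (((stage I Θ n).forget i).continuous.comp (continuous_apply (n + 1))) (continuous_apply n)
  exact isCompact_iff_compactSpace.1 h.isCompact

variable {I Θ}

/-- The truncation of a type to a hierarchy of order `n + 1`. -/
noncomputable def UType.trunc {i : I} (n : ℕ) : C(UType I Θ i, (stage I Θ n).Ty i) :=
  ⟨fun t => t.1 n, (continuous_apply n).comp continuous_subtype_val⟩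

/-- The belief of order `n + 1` of a type. -/
noncomputable def UType.belief {i : I} (n : ℕ) (t : UType I Θ i) : Delta ((stage I Θ n).Dom i) :=
  (stage I Θ n).last i (t.trunc n)

/-- The projection from `Θ` and the universal types of the other agents to the domain of the
beliefs of order `n + 1`. -/
noncomputable def domProj (i : I) (n : ℕ) : C(Θ × Others (UType I Θ) i, (stage I Θ n).Dom i) :=
  ((stage I Θ n).restrict i).comp
    ⟨fun x => (x.1, fun j => UType.trunc n (x.2 j)), by fun_prop⟩

/-- Every type determines exactly one belief about `Θ` and the types of the others whose marginals
are the beliefs in its hierarchy. -/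
theorem existsUnique_universalBelief (i : I) (t : UType I Θ i) :
    ∃! μ : Delta (Θ × Others (UType I Θ) i), ∀ n, Delta.map (domProj i n) μ = t.belief n := by
  refine Delta.exists_unique_limit (X := fun n => (stage I Θ n).Dom i)
    (fun n => (stage I Θ n).restrict i) (fun n => t.belief n) (fun n => ?_) (domProj i)
    (fun n z => ?_) (fun x hx => ?_) (fun z z' h => ?_)
  · exact (t.1 (n + 1)).2.trans (congrArg _ (t.2 n))
  · refine congrArg ((stage I Θ n).restrict i) (Prod.ext rfl (funext fun j => ?_))
    exact (z.2 j).2 n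
  · have h1 : ∀ n, (x (n + 1)).1 = (x 1).1 := by
      intro n
      induction n with
      | zero => rfl
      | succ n ih => rw [← ih]; exact congrArg Prod.fst (hx (n + 1))
    refine ⟨((x 1).1, fun j => ⟨fun n => (x (n + 1)).2 j, fun n => ?_⟩), fun n => ?_⟩
    · exact congrFun (congrArg Prod.snd (hx (n + 1))) j
    · rw [← hx n]
      exact congrArg ((stage I Θ n).restrict i) (Prod.ext (h1 n).symm rfl)
  · refine Prod.ext (h 0) (funext fun j => Subtype.ext (funext fun n => ?_))
    have h2 := congrFun (congrArg Prod.snd (h (n + 1))) j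
    exact ((z.2 j).2 n).symm.trans (h2.trans ((z'.2 j).2 n))

/-- The canonical map from types of agent `i` to beliefs about `Θ` and the types of the others. -/
noncomputable def universalBelief (i : I) (t : UType I Θ i) : Delta (Θ × Others (UType I Θ) i) :=
  (existsUnique_universalBelief i t).choose

theorem map_universalBelief (i : I) (t : UType I Θ i) (n : ℕ) :
    Delta.map (domProj i n) (universalBelief i t) = t.belief n :=
  (existsUnique_universalBelief i t).choose_spec.1 n

end Hierarchies

section Structures

variable (I : Type) (Θ : Type u) [TopologicalSpace Θ] [CompactSpace Θ] [T2Space Θ]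

/-- A state space: a nonempty compact product subspace `Θ × ∏ j, T j` of the universal state
space. It need not be belief-closed. -/
structure StateSpace where
  T : ∀ j, Set (UType I Θ j)
  nonempty : (univ ×ˢ univ.pi T : Set (Θ × ∀ j, UType I Θ j)).Nonempty
  isCompact : IsCompact (univ ×ˢ univ.pi T : Set (Θ × ∀ j, UType I Θ j))

/-- The inclusion of `Θ` times the types of the others that belong to given sets of universal types
into `Θ` times all universal types of the others. -/
def othersInclusion {I : Type} {Θ : Type u} [TopologicalSpace Θ] [CompactSpace Θ] [T2Space Θ]
    (T : ∀ j, Set (UType I Θ j)) (i : I) :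
    C(Θ × Others (fun j => T j) i, Θ × Others (UType I Θ) i) :=
  ⟨fun x => (x.1, fun j => (x.2 j : UType I Θ j)), by fun_prop⟩

/-- A (non-redundant) type structure: nonempty compact sets of universal types with continuous
belief functions `β j : T j → Δ(Θ × ∏ k ≠ j, T k)`, which are the restrictions of the universal
belief functions. -/
structure TypeStructure where
  T : ∀ j, Set (UType I Θ j)
  nonempty : ∀ j, (T j).Nonempty
  isCompact : ∀ j, IsCompact (T j)
  β : ∀ j, C(T j, Delta (Θ × Others (fun k => T k) j))
  β_eq : ∀ j (t : T j), Delta.map (othersInclusion T j) (β j t) = universalBelief j t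

variable {I Θ}

/-- An agent-`i`-dependent type structure: a type structure containing all the real types of
agent `i`. -/
structure AgentTypeStructure (Ω : StateSpace I Θ) (i : I) extends TypeStructure I Θ where
  real_subset : Ω.T i ⊆ T i

namespace TypeStructure

variable (S : TypeStructure I Θ)

/-- The (belief-closed) state space `Θ × ∏ j, T j` induced by a type structure. -/
abbrev State : Type u := Θ × ∀ j, S.T j

/-- `Θ × ∏ j ≠ i, T j`. -/
abbrev OtherState (i : I) : Type u := Θ × Others (fun k => S.T k) i

/-- An event is a closed product subset of the state space. -/
def IsEvent (E : Set S.State) : Prop :=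
  IsClosed E ∧ ∃ (A : Set Θ) (B : ∀ j, Set (S.T j)), E = A ×ˢ univ.pi B

/-- The projection of an event to `Θ × ∏ j ≠ i, T j`. -/
def others (E : Set S.State) (i : I) : Set (S.OtherState i) :=
  (fun ω : S.State => ((ω.1, fun j => ω.2 j) : S.OtherState i)) '' E

/-- The belief operator of agent `i`. -/
def belief (i : I) (F : Set (S.OtherState i)) : Set (Θ × S.T i) :=
  {x | (S.β i x.2).toMeasure F = 1}

/-- The mutual belief operator. -/
def mutualBelief (E : Set S.State) : Set S.State :=
  {ω | ∀ j, (ω.1, ω.2 j) ∈ S.belief j (S.others E j)}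

/-- The event that `E` holds and there is `m`-correct belief in `E`:
`CB E m = E ∩ ⋂ k < m, mutualBelief (CB E k)`; in particular `CB E 0 = E`. -/
def CB (E : Set S.State) (m : ℕ) : Set S.State :=
  E ∩ ⋂ k : Fin m, S.mutualBelief (CB E k)
termination_by m
decreasing_by exact k.2

end TypeStructure

namespace AgentTypeStructure

variable {Ω : StateSpace I Θ} {i : I}

/-- The real types of agent `i` in the projection of the `m`-correct-belief event. -/
def realCB (S : AgentTypeStructure Ω i) (E : Set S.State) (m : ℕ) : Set (UType I Θ i) :=
  ((fun ω : S.State => (ω.2 i : UType I Θ i)) '' S.CB E m) ∩ Ω.T i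

/-- The real common-correct-belief event of agent `i`. -/
def realCommonCB (S : AgentTypeStructure Ω i) (E : Set S.State) : Set (UType I Θ i) :=
  ⋂ m, S.realCB E m

end AgentTypeStructure

variable {Ω : StateSpace I Θ}

/-- The real `m`-correct-belief event of a profile of agent-dependent type structures. -/
def profileCB (S : ∀ i, AgentTypeStructure Ω i) (E : ∀ i, Set (S i).State) (m : ℕ) :
    Set (∀ i, UType I Θ i) :=
  univ.pi fun i => (S i).realCB (E i) m

/-- The real common-correct-belief event of a profile of agent-dependent type structures. -/
def profileCommonCB (S : ∀ i, AgentTypeStructure Ω i) (E : ∀ i, Set (S i).State) :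
    Set (∀ i, UType I Θ i) :=
  univ.pi fun i => (S i).realCommonCB (E i)

end Structures

/-! Everything follows from closedness: closed sets are Borel, and finite products of closed sets
also lie in the product of the Borel σ-algebras. The one analytic point is that certainty of a
closed set `F` is a closed condition on regular measures. It amounts to the vanishing of the
integrals of all continuous functions that are zero on `F`, and each such integral is continuous for
weak convergence (`Delta.isClosed_setOf_toMeasure_eq_one`). The rest is compactness. Projections of
closed events are compact, hence closed; pulling certainty back along the continuous maps `β j`
shows that mutual belief preserves closed sets; induction on the order gives
`TypeStructure.isClosed_CB`. Projecting to agent `i` and intersecting with the compact set of real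
types stays closed in the universal type space. -/

/-! ### Certainty of a closed set -/

/-- Regularity takes the place of metrizability: by inner regularity the open complement of `F` is
null once its compact subsets are, and Urysohn functions that are one on such a compact set and zero
on `F` detect these (`Delta.compl_null`). -/
theorem Delta.toMeasure_eq_one_iff {X : Type u} [TopologicalSpace X] [CompactSpace X] [T2Space X]
    (μ : Delta X) {F : Set X} (hF : IsClosed F) :
    μ.toMeasure F = 1 ↔ ∀ f : C(X, ℝ), (∀ x ∈ F, f x = 0) → μ.integral f = 0 := by
  letI : MeasurableSpace X := borel X
  haveI : BorelSpace X := ⟨rfl⟩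
  haveI := μ.isProb
  rw [← prob_compl_eq_zero_iff hF.measurableSet]
  refine ⟨fun h f hf => integral_eq_zero_of_ae ?_, μ.compl_null hF⟩
  -- A null complement is, by definition, almost sure membership in `F`.
  have hae : ∀ᵐ x ∂μ.toMeasure, x ∈ F := h
  filter_upwards [hae] with x hx using hf x hx

/-- Certain belief in a closed set is a closed condition on the measure. -/
theorem Delta.isClosed_setOf_toMeasure_eq_one {X : Type u} [TopologicalSpace X] [CompactSpace X]
    [T2Space X] {F : Set X} (hF : IsClosed F) : IsClosed {μ : Delta X | μ.toMeasure F = 1} := by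
  simp only [Delta.toMeasure_eq_one_iff _ hF, ofPred_forall]
  exact isClosed_iInter fun f => isClosed_iInter fun _ =>
    isClosed_eq (Delta.continuous_integral f) continuous_const

/-! ### Closedness of the correct-belief events -/

section Closed

variable {I : Type} {Θ : Type u} [TopologicalSpace Θ] [CompactSpace Θ] [T2Space Θ]

/-- Makes `S.State` and every `S.OtherState i` compact Hausdorff by instance inference. -/
instance TypeStructure.instCompactSpaceT (S : TypeStructure I Θ) (j : I) : CompactSpace (S.T j) :=
  isCompact_iff_compactSpace.1 (S.isCompact j)

theorem TypeStructure.isClosed_others (S : TypeStructure I Θ) {E : Set S.State} (hE : IsClosed E)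
    (i : I) : IsClosed (S.others E i) :=
  (hE.isCompact.image (by fun_prop)).isClosed

/-- For each agent `j` the condition is the preimage of a closed set of measures under the
continuous map `ω ↦ β j (ω.2 j)`. -/
theorem TypeStructure.isClosed_mutualBelief (S : TypeStructure I Θ) {E : Set S.State}
    (hE : IsClosed E) : IsClosed (S.mutualBelief E) := by
  rw [TypeStructure.mutualBelief, ofPred_forall]
  exact isClosed_iInter fun j => (Delta.isClosed_setOf_toMeasure_eq_one
    (S.isClosed_others hE j)).preimage
      ((S.β j).continuous.comp ((continuous_apply j).comp continuous_snd))

theorem TypeStructure.isClosed_CB (S : TypeStructure I Θ) {E : Set S.State} (hE : IsClosed E)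
    (m : ℕ) : IsClosed (S.CB E m) := by
  -- Strong induction, because `CB E m` involves all lower orders at once; for `m = 0` the
  -- intersection over `Fin 0` is the whole space.
  induction m using Nat.strong_induction_on with
  | _ m ih =>
    rw [TypeStructure.CB]
    exact hE.inter (isClosed_iInter fun k => S.isClosed_mutualBelief (ih k k.2))

/-- A state space is compact only as a product, so each factor is recovered as a continuous image.
Nonemptiness makes the coordinate projection onto. -/
theorem StateSpace.isCompact_T (Ω : StateSpace I Θ) (i : I) : IsCompact (Ω.T i) := by
  obtain ⟨⟨θ, t⟩, -, ht⟩ := Ω.nonempty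
  have h := Ω.isCompact.image ((continuous_apply i).comp continuous_snd)
  convert h using 1
  classical
  -- The base state `(θ, t)` supplies all coordinates other than `i`.
  refine Subset.antisymm (fun x hx => ⟨(θ, Function.update t i x), ⟨mem_univ _, fun j _ => ?_⟩,
    Function.update_self i x t⟩) ?_
  · rcases eq_or_ne j i with rfl | hj
    · simpa using hx
    · simpa [Function.update_of_ne hj] using ht j (mem_univ j)
  · rintro _ ⟨ω, hω, rfl⟩
    exact hω.2 i (mem_univ i)

variable {Ω : StateSpace I Θ} {i : I}

theorem AgentTypeStructure.isClosed_realCB (S : AgentTypeStructure Ω i) {E : Set S.State}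
    (hE : IsClosed E) (m : ℕ) : IsClosed (S.realCB E m) :=
  ((S.isClosed_CB hE m).isCompact.image (by fun_prop)).isClosed.inter (Ω.isCompact_T i).isClosed

/-- The intersection over orders is taken after projecting, so it need not be shown to commute with
the projection. -/
theorem AgentTypeStructure.isClosed_realCommonCB (S : AgentTypeStructure Ω i) {E : Set S.State}
    (hE : IsClosed E) : IsClosed (S.realCommonCB E) :=
  isClosed_iInter fun m => S.isClosed_realCB hE m

end Closed

/-! ### Measurability -/

theorem IsClosed.measurableSet_of_borel {X : Type u} [TopologicalSpace X] {s : Set X}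
    (hs : IsClosed s) : MeasurableSet[borel X] s := by
  letI : MeasurableSpace X := borel X
  haveI : BorelSpace X := ⟨rfl⟩
  exact hs.measurableSet

/-- A finite product of closed sets is closed, and measurable both for the Borel `σ`-algebra of the
product and for the product of the Borel `σ`-algebras. -/
theorem isClosed_measurableSet_univ_pi {I : Type} [Finite I] {X : I → Type u}
    [∀ i, TopologicalSpace (X i)] {s : ∀ i, Set (X i)} (hs : ∀ i, IsClosed (s i)) :
    IsClosed (univ.pi s) ∧ MeasurableSet[borel (∀ i, X i)] (univ.pi s) ∧
      MeasurableSet[@MeasurableSpace.pi I X fun i => borel (X i)] (univ.pi s) := by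
  have h : IsClosed (univ.pi s) := isClosed_set_pi fun i _ => hs i
  refine ⟨h, h.measurableSet_of_borel, ?_⟩
  letI : ∀ i, MeasurableSpace (X i) := fun i => borel (X i)
  -- Finiteness of `I` enters here, through countability: the box is a countable intersection of
  -- measurable cylinders. This is a separate argument because, without metrizability, closed
  -- subsets of a product need not be measurable for the product σ-algebra.
  exact MeasurableSet.univ_pi fun i => (hs i).measurableSet_of_borel

theorem mainTheorem5 {I : Type} [Finite I] {Θ : Type u} [TopologicalSpace Θ] [CompactSpace Θ]
    [T2Space Θ] (Ω : StateSpace I Θ) :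
    (∀ (i : I) (S : AgentTypeStructure Ω i) (E : Set S.State), S.IsEvent E →
      (∀ m : ℕ, IsClosed (S.realCB E m) ∧ MeasurableSet[borel (UType I Θ i)] (S.realCB E m)) ∧
      IsClosed (S.realCommonCB E) ∧ MeasurableSet[borel (UType I Θ i)] (S.realCommonCB E)) ∧
    (∀ (S : ∀ i, AgentTypeStructure Ω i) (E : ∀ i, Set (S i).State), (∀ i, (S i).IsEvent (E i)) →
      (∀ m : ℕ, IsClosed (profileCB S E m) ∧
        MeasurableSet[borel (∀ i, UType I Θ i)] (profileCB S E m) ∧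
        MeasurableSet[@MeasurableSpace.pi I (UType I Θ) fun i => borel (UType I Θ i)]
          (profileCB S E m)) ∧
      IsClosed (profileCommonCB S E) ∧
        MeasurableSet[borel (∀ i, UType I Θ i)] (profileCommonCB S E) ∧
        MeasurableSet[@MeasurableSpace.pi I (UType I Θ) fun i => borel (UType I Θ i)]
          (profileCommonCB S E)) := by
  refine ⟨fun i S E hE => ⟨fun m => ?_, ?_⟩, fun S E hE => ⟨fun m => ?_, ?_⟩⟩
  · exact ⟨S.isClosed_realCB hE.1 m, (S.isClosed_realCB hE.1 m).measurableSet_of_borel⟩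
  · exact ⟨S.isClosed_realCommonCB hE.1, (S.isClosed_realCommonCB hE.1).measurableSet_of_borel⟩
  · exact isClosed_measurableSet_univ_pi fun i => (S i).isClosed_realCB (hE i).1 m
  · exact isClosed_measurableSet_univ_pi fun i => (S i).isClosed_realCommonCB (hE i).1
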